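/- Let $\Bbbk$ be a field, $\theta\in\mathbb N_0$ and $\mathbb I=\{1,\dots,\theta\}$. For a matrix $\mathfrak q=(q_{ij})_{i,j\in\mathbb I}$ with entries in $\Bbbk^\times$ let $V$ be the braided vector space with basis $(x_i)_{i\in\mathbb I}$ and braiding $c(x_i\otimes x_j)=q_{ij}\,x_j\otimes x_i$. The tensor algebra $T(V)$ is $\mathbb N_0^\theta$-graded with $\deg x_i=\alpha_i$ (the $i$-th canonical basis vector), and it is a braided Hopf algebra in which every $x_i$ is primitive. An $\mathbb N_0^\theta$-graded pre-Nichols algebra of $\mathfrak q$ is a quotient $\mathscr B=T(V)/\mathcal J$ by an $\mathbb N_0^\theta$-homogeneous (braided) Hopf ideal $\mathcal J$ contained in $\bigoplus_{n\ge 2}V^{\otimes n}$; it is a braided Hopf algebra and inherits a grading $\mathscr B=\bigoplus_{\alpha\in\mathbb N_0^\theta}\mathscr B_\alpha$. Its Hilbert series is $\mathcal H_{\mathscr B}=\sum_\alpha\dim\mathscr B_\alpha\,t^\alpha\in\mathbb N_0[[t_1,\dots,t_\theta]]$. These algebras form a poset $\mathfrak{Pre}_{gr}(\mathfrak q)$,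 where $\mathscr B_1\le\mathscr B_2$ if $\mathrm{id}_V$ induces an epimorphism of braided Hopf algebras $\mathscr B_1\twoheadrightarrow\mathscr B_2$. Let $\mathfrak{Pre}_{fGK,gr}(\mathfrak q)$ be the subposet of those of finite Gelfand-Kirillov dimension. Let $\mathfrak q=(q_{ij})$ and $\mathfrak p=(p_{ij})$ be twist-equivalent, i.e. $q_{ii}=p_{ii}$ for all $i$ and $q_{ij}q_{ji}=p_{ij}p_{ji}$ for all $i\ne j$ (equivalently, they have the same Dynkin diagram). Let $\sigma:\mathbb Z^\theta\times\mathbb Z^\theta\to\Bbbk^\times$ be the bicharacter with $\sigma(\alpha_i,\alpha_j)=p_{ij}q_{ij}^{-1}$ if $i\le j$ and $\sigma(\alpha_i,\alpha_j)=1$ if $i>j$. Then $\sigma$ is a (normalized) group 2-cocycle, and: (i) There is an isomorphism of posets $\Psi:\mathfrak{Pre}_{gr}(\mathfrak q)\to\mathfrak{Pre}_{gr}(\mathfrak p)$ such that $\mathcal H_{\Psi(\mathscr B)}=\mathcal H_{\mathscr B}$ for all $\mathscr B$. It is the cocycle twist $\Psi(\mathscr B)\simeq\mathscr B_\sigma$,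 by an isomorphism preserving the generators $x_i$; here $\mathscr B_\sigma$ is the graded vector space $\mathscr B$ with the same unit, with the product $b\cdot_\sigma c=\sigma(\beta,\gamma)\,bc$ for $b\in\mathscr B_\beta$, $c\in\mathscr B_\gamma$, and with the coproduct $\Delta_\sigma=D\circ\Delta$, where $D(b\otimes c)=\sigma(\beta,\gamma)^{-1}\,b\otimes c$ for $b\in\mathscr B_\beta$, $c\in\mathscr B_\gamma$. (ii) $\Psi$ restricts to an isomorphism of posets $\mathfrak{Pre}_{fGK,gr}(\mathfrak q)\to\mathfrak{Pre}_{fGK,gr}(\mathfrak p)$. -/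

import Mathlib

open scoped TensorProduct

noncomputable section

namespace DiagonalType

variable {k : Type*} [Field k] {θ : ℕ}

/-- Two braiding matrices are twist-equivalent, i.e. they have the same Dynkin diagram. -/
def TwistEquiv (q p : Matrix (Fin θ) (Fin θ) kˣ) : Prop :=
  (∀ i, q i i = p i i) ∧ ∀ i j, i ≠ j → q i j * q j i = p i j * p j i

/-! ### The tensor algebra as a braided Hopf algebra -/

/-- The tensor algebra `T(V)` of the vector space `V` with basis `x₁, …, x_θ`. -/
abbrev T (k : Type*) [Field k] (θ : ℕ) : Type _ := FreeAlgebra k (Fin θ)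

/-- The generator `x_i`. -/
abbrev x (k : Type*) [Field k] {θ : ℕ} (i : Fin θ) : T k θ := FreeAlgebra.ι k i

/-- The basis of `T(V)` formed by the monomials `x_w = x_{i₁} ⋯ x_{iₙ}`, for words `w = i₁ ⋯ iₙ`. -/
abbrev wordBasis (k : Type*) [Field k] (θ : ℕ) : Module.Basis (FreeMonoid (Fin θ)) k (T k θ) :=
  FreeAlgebra.basisFreeMonoid k (Fin θ)

/-- Check: the basis element of a word is the product of the corresponding generators. -/
theorem wordBasis_apply (w : FreeMonoid (Fin θ)) :
    wordBasis k θ w = FreeMonoid.lift (x k) w := by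
  simp [FreeAlgebra.basisFreeMonoid, FreeAlgebra.equivMonoidAlgebraFreeMonoid]

/-- The degree in `ℕ^θ` of a word: the number of occurrences of each letter. -/
def wordDeg (w : FreeMonoid (Fin θ)) : Fin θ →₀ ℕ :=
  Multiset.toFinsupp (w.toList : Multiset (Fin θ))

/-- The inclusion of `ℕ^θ` in `ℤ^θ`. -/
def toZ (α : Fin θ →₀ ℕ) : Fin θ → ℤ := fun i => (α i : ℤ)

/-- The homogeneous component of degree `α` of `T(V)`. -/
def homPart (k : Type*) [Field k] {θ : ℕ} (α : Fin θ →₀ ℕ) : Submodule k (T k θ) :=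
  Submodule.span k (wordBasis k θ '' {w | wordDeg w = α})

/-- The action of `g ∈ ℤ^θ` on `T(V)` by algebra maps, where `α_i · x_j = q_{ij} x_j`. -/
def act (q : Matrix (Fin θ) (Fin θ) kˣ) (g : Fin θ → ℤ) : T k θ →ₐ[k] T k θ :=
  FreeAlgebra.lift k fun j => ((∏ i, q i j ^ g i : kˣ) : k) • x k j

/-- The braiding of `T(V)` as a Yetter-Drinfeld module over the group algebra of `ℤ^θ`:
`c (a ⊗ b) = (g · b) ⊗ a` for `a` homogeneous of degree `g`. -/
def braiding (q : Matrix (Fin θ) (Fin θ) kˣ) : T k θ ⊗[k] T k θ →ₗ[k] T k θ ⊗[k] T k θ :=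
  TensorProduct.lift <| (wordBasis k θ).constr k fun w =>
    (TensorProduct.mk k (T k θ) (T k θ)).flip (wordBasis k θ w) ∘ₗ
      (act q (toZ (wordDeg w))).toLinearMap

/-- The product of the braided tensor product algebra `T(V) ⊗ T(V)`, that is
`(m ⊗ m) (id ⊗ c ⊗ id)`. -/
def braidedMul (q : Matrix (Fin θ) (Fin θ) kˣ) :
    T k θ ⊗[k] T k θ →ₗ[k] T k θ ⊗[k] T k θ →ₗ[k] T k θ ⊗[k] T k θ :=
  TensorProduct.curry <|
    TensorProduct.map (LinearMap.mul' k (T k θ)) (LinearMap.mul' k (T k θ)) ∘ₗ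
    (TensorProduct.assoc k (T k θ) (T k θ) (T k θ ⊗[k] T k θ)).symm.toLinearMap ∘ₗ
    LinearMap.lTensor (T k θ)
      ((TensorProduct.assoc k (T k θ) (T k θ) (T k θ)).toLinearMap ∘ₗ
        LinearMap.rTensor (T k θ) (braiding q) ∘ₗ
        (TensorProduct.assoc k (T k θ) (T k θ) (T k θ)).symm.toLinearMap) ∘ₗ
    (TensorProduct.assoc k (T k θ) (T k θ) (T k θ ⊗[k] T k θ)).toLinearMap

/-- The coproduct of `T(V)`: the algebra map to the braided tensor square for which the `x_i` are
primitive, `Δ(x_{i₁} ⋯ x_{iₙ}) = Δ(x_{i₁}) (Δ(x_{i₂}) ( ⋯ (Δ(x_{iₙ}) (1 ⊗ 1))))`. -/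
def comul (q : Matrix (Fin θ) (Fin θ) kˣ) : T k θ →ₗ[k] T k θ ⊗[k] T k θ :=
  LinearMap.applyₗ (1 ⊗ₜ[k] 1) ∘ₗ
    (FreeAlgebra.lift k fun i : Fin θ =>
      (braidedMul q (x k i ⊗ₜ[k] 1 + 1 ⊗ₜ[k] x k i) :
        Module.End k (T k θ ⊗[k] T k θ))).toLinearMap

/-- The counit of `T(V)`, the algebra map with `x_i ↦ 0`. -/
def counit (k : Type*) [Field k] (θ : ℕ) : T k θ →ₐ[k] k := FreeAlgebra.lift k fun _ => 0

/-- The antipode of `T(V)`: it satisfies `S(1) = 1` and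
`S(x_i t) = (m (S ⊗ S) c) (x_i ⊗ t) = -(α_i · S(t)) x_i`. -/
def antipode (q : Matrix (Fin θ) (Fin θ) kˣ) : T k θ →ₗ[k] T k θ :=
  LinearMap.applyₗ 1 ∘ₗ
    (FreeAlgebra.lift k fun i : Fin θ =>
      (-(LinearMap.mulRight k (x k i) ∘ₗ (act q (Pi.single i 1)).toLinearMap) :
        Module.End k (T k θ))).toLinearMap

/-! ### Pre-Nichols algebras -/

/-- `J` is a Hopf ideal of the braided Hopf algebra `T(V)`. -/
structure IsHopfIdeal (q : Matrix (Fin θ) (Fin θ) kˣ) (J : Ideal (T k θ)) : Prop where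
  isTwoSided : J.IsTwoSided
  /-- `Δ(J) ⊆ J ⊗ T(V) + T(V) ⊗ J`. -/
  comul_mem : ∀ t ∈ J, comul q t ∈
    LinearMap.range (LinearMap.rTensor (T k θ) (J.restrictScalars k).subtype) ⊔
      LinearMap.range (LinearMap.lTensor (T k θ) (J.restrictScalars k).subtype)
  counit_eq_zero : ∀ t ∈ J, counit k θ t = 0
  antipode_mem : ∀ t ∈ J, antipode q t ∈ J

/-- An `ℕ^θ`-graded pre-Nichols algebra of the braided vector space of diagonal type with matrix
`q`: a quotient of `T(V)` by an `ℕ^θ`-homogeneous Hopf ideal concentrated in (total) degrees at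
least two. -/
structure PreNichols (q : Matrix (Fin θ) (Fin θ) kˣ) where
  ideal : Ideal (T k θ)
  isHopfIdeal : IsHopfIdeal q ideal
  homogeneous : ideal.restrictScalars k =
    ⨆ α : {α : Fin θ →₀ ℕ // 2 ≤ α.degree}, ideal.restrictScalars k ⊓ homPart k α.1

namespace PreNichols

variable {q p : Matrix (Fin θ) (Fin θ) kˣ}

instance (B : PreNichols q) : B.ideal.IsTwoSided := B.isHopfIdeal.isTwoSided

/-- The underlying algebra `T(V) / J`. -/
abbrev Alg (B : PreNichols q) : Type _ := T k θ ⧸ B.ideal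

/-- The canonical projection from `T(V)`. -/
abbrev proj (B : PreNichols q) : T k θ →ₐ[k] B.Alg := Ideal.Quotient.mkₐ k B.ideal

/-- The coproduct of `T(V) / J`, induced by that of `T(V)`. -/
def comul (B : PreNichols q) : B.Alg →ₗ[k] B.Alg ⊗[k] B.Alg :=
  (B.ideal.restrictScalars k).liftQ
      (TensorProduct.map B.proj.toLinearMap B.proj.toLinearMap ∘ₗ DiagonalType.comul q) (by
    intro t ht
    have hz : ∀ y : (B.ideal.restrictScalars k : Submodule k (T k θ)),
        Ideal.Quotient.mk B.ideal (y : T k θ) = 0 := fun y => Ideal.Quotient.eq_zero_iff_mem.2 y.2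
    refine (sup_le ?_ ?_ : _ ≤ LinearMap.ker
      (TensorProduct.map B.proj.toLinearMap B.proj.toLinearMap))
      (B.isHopfIdeal.comul_mem t ht)
    · rw [LinearMap.range_le_ker_iff]
      ext y z
      simp [hz y]
    · rw [LinearMap.range_le_ker_iff]
      ext y z
      simp [hz z]) ∘ₗ
    (Submodule.Quotient.restrictScalarsEquiv k B.ideal).symm.toLinearMap

theorem comul_proj (B : PreNichols q) (t : T k θ) : B.comul (B.proj t) =
    TensorProduct.map B.proj.toLinearMap B.proj.toLinearMap (DiagonalType.comul q t) := by
  rfl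

/-- The homogeneous component of degree `α` of a pre-Nichols algebra. -/
def gr (B : PreNichols q) (α : Fin θ →₀ ℕ) : Submodule k B.Alg :=
  (homPart k α).map B.proj.toLinearMap

/-- The (multivariate) Hilbert series. -/
def hilbertSeries (B : PreNichols q) : MvPowerSeries (Fin θ) ℕ :=
  fun α => Module.finrank k (B.gr α)

/-- `B₁ ≤ B₂` when the identity of `V` induces an epimorphism of braided Hopf algebras
`B₁ → B₂`. -/
instance : LE (PreNichols q) where
  le B₁ B₂ := ∃ f : B₁.Alg →ₐ[k] B₂.Alg, Function.Surjective f ∧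
    (∀ i, f (B₁.proj (x k i)) = B₂.proj (x k i)) ∧
    ∀ b, B₂.comul (f b) = TensorProduct.map f.toLinearMap f.toLinearMap (B₁.comul b)

theorem le_iff (B₁ B₂ : PreNichols q) : B₁ ≤ B₂ ↔ B₁.ideal ≤ B₂.ideal := by
  constructor
  · rintro ⟨f, -, hf, -⟩ t ht
    have h : f.comp B₁.proj = B₂.proj := FreeAlgebra.hom_ext (funext hf)
    have h' := DFunLike.congr_fun h t
    rw [AlgHom.comp_apply, show B₁.proj t = 0 from Ideal.Quotient.eq_zero_iff_mem.2 ht,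
      map_zero] at h'
    exact Ideal.Quotient.eq_zero_iff_mem.1 h'.symm
  · intro h
    refine ⟨Ideal.Quotient.factorₐ k h, Ideal.Quotient.factor_surjective h, fun i => rfl, ?_⟩
    intro b
    obtain ⟨t, rfl⟩ := Ideal.Quotient.mk_surjective b
    change B₂.comul (B₂.proj t) = TensorProduct.map _ _ (B₁.comul (B₁.proj t))
    rw [comul_proj, comul_proj, ← LinearMap.comp_apply (TensorProduct.map _ _)
      (TensorProduct.map _ _), ← TensorProduct.map_comp]
    rfl

instance : PartialOrder (PreNichols q) where
  le_refl B := (le_iff B B).2 le_rfl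
  le_trans B₁ B₂ B₃ h h' :=
    (le_iff B₁ B₃).2 (((le_iff B₁ B₂).1 h).trans ((le_iff B₂ B₃).1 h'))
  le_antisymm B₁ B₂ h h' := by
    have e : B₁.ideal = B₂.ideal := le_antisymm ((le_iff B₁ B₂).1 h) ((le_iff B₂ B₁).1 h')
    cases B₁; cases B₂; cases e; rfl

end PreNichols

/-! ### Gelfand-Kirillov dimension -/

/-- The Gelfand-Kirillov dimension of a `k`-algebra: the supremum over the finite-dimensional
subspaces `V` of `limsup (log dim (k + V + ⋯ + V ^ n) / log n)`. -/
def gkDim (k : Type*) [Field k] (A : Type*) [Ring A] [Algebra k A] : EReal :=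
  ⨆ V : {V : Submodule k A // FiniteDimensional k V},
    Filter.limsup (fun n : ℕ =>
      ((Real.log (Module.finrank k (⨆ i : Fin (n + 1), V.1 ^ (i : ℕ) : Submodule k A)) /
        Real.log n : ℝ) : EReal)) Filter.atTop

/-- The `ℕ^θ`-graded pre-Nichols algebras of finite Gelfand-Kirillov dimension, with the induced
order. -/
abbrev FinPreNichols (q : Matrix (Fin θ) (Fin θ) kˣ) : Type _ :=
  {B : PreNichols q // gkDim k B.Alg < ⊤}

/-! ### Cocycle twists -/

/-- Normalized group 2-cocycles on `ℤ^θ` with values in the trivial module `kˣ`. -/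
structure IsTwoCocycle (σ : (Fin θ → ℤ) → (Fin θ → ℤ) → kˣ) : Prop where
  cocycle : ∀ a b c, σ a b * σ (a + b) c = σ b c * σ a (b + c)
  left_zero : ∀ a, σ 0 a = 1
  right_zero : ∀ a, σ a 0 = 1

/-- The bicharacter of `ℤ^θ` with `σ(α_i, α_j) = p_{ij} q_{ij}⁻¹` if `i ≤ j`, and `1` if `i > j`. -/
def twistCocycle (q p : Matrix (Fin θ) (Fin θ) kˣ) (a b : Fin θ → ℤ) : kˣ :=
  ∏ i, ∏ j, if i ≤ j then (p i j * (q i j)⁻¹) ^ (a i * b j) else 1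

/-- `B'` is (through an isomorphism `e` fixing the generators) the cocycle twist `B_σ`: it has the
homogeneous components and the unit of `B`, the product `σ(β, γ) b c` and the coproduct
`∑ σ(β, γ)⁻¹ b₁ ⊗ b₂`, where `β` and `γ` are the degrees of the two (homogeneous) factors. This is
what the twist of the bosonization by the 2-cocycle `σ`, in which the coproduct of the bosonization
is unchanged, induces on the algebra of coinvariants. -/
def IsCocycleTwist (σ : (Fin θ → ℤ) → (Fin θ → ℤ) → kˣ) {q p : Matrix (Fin θ) (Fin θ) kˣ}
    (B : PreNichols q) (B' : PreNichols p) : Prop :=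
  ∃ (e : B'.Alg ≃ₗ[k] B.Alg) (D : B.Alg ⊗[k] B.Alg →ₗ[k] B.Alg ⊗[k] B.Alg),
    e 1 = 1 ∧
    (∀ i, e (B'.proj (x k i)) = B.proj (x k i)) ∧
    (∀ α, (B'.gr α).map e.toLinearMap = B.gr α) ∧
    (∀ β γ, ∀ b ∈ B'.gr β, ∀ c ∈ B'.gr γ,
      e (b * c) = (σ (toZ β) (toZ γ) : k) • (e b * e c)) ∧
    (∀ β γ, ∀ b ∈ B.gr β, ∀ c ∈ B.gr γ,
      D (b ⊗ₜ[k] c) = ((σ (toZ β) (toZ γ))⁻¹ : kˣ).val • (b ⊗ₜ[k] c)) ∧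
    ∀ b, TensorProduct.map e.toLinearMap e.toLinearMap (B'.comul b) = D (B.comul (e b))

end DiagonalType

end

/-!
The monomials `x_w` form a basis of `T(V)`. In the twisted algebra `T(V)_σ` the product of the letters
of `w` is the multiple `c(w) x_w`, where `c(w)` is the product of the values `σ(α_{i_a}, α_{i_b})` over
the positions `a < b` of `w`; hence `c(uv) = σ(u, v) c(u) c(v)`. The twist is therefore realized on the
fixed vector space `T(V)` by the diagonal linear automorphism `e : x_w ↦ c(w) x_w` (`twist`), which
satisfies `e(st) = σ(β, γ) e(s) e(t)` on homogeneous elements (`twist_mul`).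

Twist-equivalence enters through one identity only: the quotient of the bicharacters of `p` and `q`
is `σ(a, b) σ(b, a)⁻¹` (`TwistEquiv.bichar_mul`). It gives `e S_p = S_q e` for the antipodes
(`TwistEquiv.antipode_twist`) and `(e ⊗ e) Δ_p = D Δ_q e` for the coproducts
(`TwistEquiv.map_twist_comul`), where `D` divides the component of bidegree `(β, γ)` by `σ(β, γ)`.
The second identity is most easily checked for the operator `D⁻¹ (e ⊗ e)`, which multiplies
`x_u ⊗ x_v` by `c(uv)`.

Consequently `J ↦ e⁻¹(J)` carries homogeneous Hopf ideals for `q` to those for `p`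
(`PreNichols.twisted`). The map `e` for the pair `(p, q)` is inverse to that for `(q, p)`, so this is
an isomorphism of posets, and `e` descends to the required isomorphism onto the cocycle twist. It
preserves homogeneous components, hence Hilbert series. As `e` scales each word, it also preserves the
spans of sets of words; a power of the span of the words in `F` is the span of the words in a power of
`F`, and every finite-dimensional subspace lies in the span of finitely many words, so
Gelfand-Kirillov dimensions agree (`PreNichols.gkDim_twisted`).
-/

noncomputable section

namespace DiagonalType

variable {k : Type*} [Field k] {θ : ℕ}

/-! ### Words and their degrees -/

theorem wordDeg_one : wordDeg (1 : FreeMonoid (Fin θ)) = 0 := by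
  simp [wordDeg]

theorem wordDeg_mul (u v : FreeMonoid (Fin θ)) : wordDeg (u * v) = wordDeg u + wordDeg v := by
  simp [wordDeg, FreeMonoid.toList_mul, ← Multiset.coe_add]

theorem wordDeg_of (i : Fin θ) : wordDeg (FreeMonoid.of i) = Finsupp.single i 1 := by
  simp [wordDeg, FreeMonoid.toList_of, Multiset.toFinsupp_singleton]

theorem toZ_zero : toZ (0 : Fin θ →₀ ℕ) = 0 := by
  ext; simp [toZ]

theorem toZ_add (α β : Fin θ →₀ ℕ) : toZ (α + β) = toZ α + toZ β := by
  ext; simp [toZ]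

theorem toZ_single (i : Fin θ) : toZ (Finsupp.single i 1) = Pi.single i 1 := by
  ext j; by_cases h : j = i
  · subst h; simp [toZ]
  · simp [toZ, h]

theorem wordBasis_one : wordBasis k θ 1 = 1 := by
  rw [wordBasis_apply, map_one]

theorem wordBasis_mul (u v : FreeMonoid (Fin θ)) :
    wordBasis k θ (u * v) = wordBasis k θ u * wordBasis k θ v := by
  simp only [wordBasis_apply, map_mul]

theorem wordBasis_of (i : Fin θ) : wordBasis k θ (FreeMonoid.of i) = x k i := by
  rw [wordBasis_apply, FreeMonoid.lift_eval_of]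

theorem wordBasis_mem_homPart (w : FreeMonoid (Fin θ)) :
    wordBasis k θ w ∈ homPart k (wordDeg w) :=
  Submodule.subset_span ⟨w, rfl, rfl⟩

/-! ### Bicharacters -/

/-- The bicharacter of `ℤ^θ` with `(α_i, α_j) ↦ m_{ij}`. -/
def bichar (m : Matrix (Fin θ) (Fin θ) kˣ) (a b : Fin θ → ℤ) : kˣ :=
  ∏ i, ∏ j, m i j ^ (a i * b j)

theorem bichar_add_left (m : Matrix (Fin θ) (Fin θ) kˣ) (a b c : Fin θ → ℤ) :
    bichar m (a + b) c = bichar m a c * bichar m b c := by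
  simp [bichar, add_mul, zpow_add, Finset.prod_mul_distrib]

theorem bichar_add_right (m : Matrix (Fin θ) (Fin θ) kˣ) (a b c : Fin θ → ℤ) :
    bichar m a (b + c) = bichar m a b * bichar m a c := by
  simp [bichar, mul_add, zpow_add, Finset.prod_mul_distrib]

theorem bichar_zero_left (m : Matrix (Fin θ) (Fin θ) kˣ) (a : Fin θ → ℤ) :
    bichar m 0 a = 1 := by
  simp [bichar]

theorem bichar_zero_right (m : Matrix (Fin θ) (Fin θ) kˣ) (a : Fin θ → ℤ) :
    bichar m a 0 = 1 := by
  simp [bichar]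

theorem bichar_single_right (m : Matrix (Fin θ) (Fin θ) kˣ) (a : Fin θ → ℤ) (j : Fin θ) :
    bichar m a (Pi.single j 1) = ∏ i, m i j ^ a i := by
  refine Finset.prod_congr rfl fun i _ => ?_
  rw [Finset.prod_eq_single j] <;> simp +contextual

theorem twistCocycle_eq_bichar (q p : Matrix (Fin θ) (Fin θ) kˣ) :
    twistCocycle q p = bichar (.of fun i j => if i ≤ j then p i j * (q i j)⁻¹ else 1) := by
  ext a b
  simp only [twistCocycle, bichar, Matrix.of_apply, ite_pow, one_zpow]

theorem twistCocycle_add_left (q p : Matrix (Fin θ) (Fin θ) kˣ) (a b c : Fin θ → ℤ) :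
    twistCocycle q p (a + b) c = twistCocycle q p a c * twistCocycle q p b c := by
  rw [twistCocycle_eq_bichar, bichar_add_left]

theorem twistCocycle_add_right (q p : Matrix (Fin θ) (Fin θ) kˣ) (a b c : Fin θ → ℤ) :
    twistCocycle q p a (b + c) = twistCocycle q p a b * twistCocycle q p a c := by
  rw [twistCocycle_eq_bichar, bichar_add_right]

theorem twistCocycle_zero_left (q p : Matrix (Fin θ) (Fin θ) kˣ) (a : Fin θ → ℤ) :
    twistCocycle q p 0 a = 1 := by
  rw [twistCocycle_eq_bichar, bichar_zero_left]

theorem twistCocycle_zero_right (q p : Matrix (Fin θ) (Fin θ) kˣ) (a : Fin θ → ℤ) :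
    twistCocycle q p a 0 = 1 := by
  rw [twistCocycle_eq_bichar, bichar_zero_right]

theorem isTwoCocycle_twistCocycle (q p : Matrix (Fin θ) (Fin θ) kˣ) :
    IsTwoCocycle (twistCocycle q p) where
  cocycle a b c := by
    rw [twistCocycle_add_left, twistCocycle_add_right]
    simp only [mul_comm, mul_left_comm]
  left_zero := twistCocycle_zero_left q p
  right_zero := twistCocycle_zero_right q p

theorem twistCocycle_swap (q p : Matrix (Fin θ) (Fin θ) kˣ) (a b : Fin θ → ℤ) :
    twistCocycle p q a b = (twistCocycle q p a b)⁻¹ := by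
  simp only [twistCocycle, ← Finset.prod_inv_distrib]
  refine Finset.prod_congr rfl fun i _ => Finset.prod_congr rfl fun j _ => ?_
  split_ifs
  · rw [← inv_zpow, mul_inv_rev, inv_inv]
  · simp

theorem TwistEquiv.symm {q p : Matrix (Fin θ) (Fin θ) kˣ} (h : TwistEquiv q p) :
    TwistEquiv p q :=
  ⟨fun i => (h.1 i).symm, fun i j hij => (h.2 i j hij).symm⟩

/-- The quotient of the bicharacters of `p` and `q` is the antisymmetrization of the twisting
cocycle; everything else about twist-equivalent matrices is deduced from this. -/
theorem TwistEquiv.bichar_mul {q p : Matrix (Fin θ) (Fin θ) kˣ} (h : TwistEquiv q p)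
    (a b : Fin θ → ℤ) :
    bichar p a b * twistCocycle q p b a = twistCocycle q p a b * bichar q a b := by
  have hs : twistCocycle q p b a =
      ∏ i, ∏ j, if j ≤ i then (p j i * (q j i)⁻¹) ^ (a i * b j) else 1 := by
    rw [twistCocycle, Finset.prod_comm]
    simp only [mul_comm (b _)]
  rw [hs]
  simp only [bichar, twistCocycle, ← Finset.prod_mul_distrib]
  refine Finset.prod_congr rfl fun i _ => Finset.prod_congr rfl fun j _ => ?_
  rcases lt_trichotomy i j with hij | rfl | hij
  · rw [if_neg hij.not_ge, if_pos hij.le, mul_one, ← mul_zpow, inv_mul_cancel_right]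
  · rw [h.1 i, mul_comm]
  · rw [if_pos hij.le, if_neg hij.not_ge, one_mul, ← mul_zpow, ← mul_assoc, ← h.2 i j hij.ne',
      mul_inv_cancel_right]

/-! ### The structure maps of the tensor algebra on words -/

theorem act_wordBasis (q : Matrix (Fin θ) (Fin θ) kˣ) (g : Fin θ → ℤ)
    (w : FreeMonoid (Fin θ)) :
    act q g (wordBasis k θ w) = (bichar q g (toZ (wordDeg w)) : k) • wordBasis k θ w := by
  induction w using FreeMonoid.inductionOn' with
  | one => simp [wordBasis_one, wordDeg_one, toZ_zero, bichar_zero_right]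
  | of_mul i w ih =>
    rw [wordBasis_mul, map_mul, ih, wordBasis_of, wordDeg_mul, toZ_add, wordDeg_of, toZ_single,
      bichar_add_right, bichar_single_right, act, FreeAlgebra.lift_ι_apply, smul_mul_smul_comm,
      Units.val_mul]

theorem act_of_mem {q : Matrix (Fin θ) (Fin θ) kˣ} (g : Fin θ → ℤ) {α : Fin θ →₀ ℕ} {t : T k θ}
    (ht : t ∈ homPart k α) : act q g t = (bichar q g (toZ α) : k) • t := by
  induction ht using Submodule.span_induction with
  | mem t ht =>
    obtain ⟨w, rfl, rfl⟩ := ht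
    exact act_wordBasis q g w
  | zero => simp
  | add s t _ _ hs ht => rw [map_add, hs, ht, smul_add]
  | smul c t _ ht => rw [map_smul, ht, smul_comm]

theorem braiding_wordBasis_tmul (q : Matrix (Fin θ) (Fin θ) kˣ) (w : FreeMonoid (Fin θ))
    (t : T k θ) :
    braiding q (wordBasis k θ w ⊗ₜ[k] t) = act q (toZ (wordDeg w)) t ⊗ₜ[k] wordBasis k θ w := by
  simp [braiding]

/-- The operator by which the generator `x_i` contributes to the coproduct. -/
theorem braidedMul_primitive (q : Matrix (Fin θ) (Fin θ) kˣ) (i : Fin θ)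
    (u v : FreeMonoid (Fin θ)) :
    braidedMul q (x k i ⊗ₜ[k] 1 + 1 ⊗ₜ[k] x k i) (wordBasis k θ u ⊗ₜ[k] wordBasis k θ v) =
      wordBasis k θ (FreeMonoid.of i * u) ⊗ₜ[k] wordBasis k θ v +
      (bichar q (toZ (wordDeg (FreeMonoid.of i))) (toZ (wordDeg u)) : k) •
        wordBasis k θ u ⊗ₜ[k] wordBasis k θ (FreeMonoid.of i * v) := by
  have h (w : FreeMonoid (Fin θ)) (a b : T k θ) :
      braidedMul q (a ⊗ₜ[k] wordBasis k θ w) (wordBasis k θ u ⊗ₜ[k] b) =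
        (a * act q (toZ (wordDeg w)) (wordBasis k θ u)) ⊗ₜ[k] (wordBasis k θ w * b) := by
    simp [braidedMul, braiding_wordBasis_tmul]
  have h1 := h 1 (x k i) (wordBasis k θ v)
  have h2 := h (FreeMonoid.of i) 1 (wordBasis k θ v)
  rw [act_wordBasis] at h1 h2
  rw [wordDeg_one, toZ_zero, bichar_zero_left, wordBasis_one, Units.val_one, one_smul,
    one_mul, ← wordBasis_of, ← wordBasis_mul] at h1
  rw [one_mul, ← wordBasis_mul, wordBasis_of, ← TensorProduct.smul_tmul'] at h2
  rw [map_add, LinearMap.add_apply, ← h2, ← wordBasis_of, h1]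

theorem comul_one (q : Matrix (Fin θ) (Fin θ) kˣ) : comul q (1 : T k θ) = 1 ⊗ₜ[k] 1 := by
  simp [comul]

theorem comul_x_mul (q : Matrix (Fin θ) (Fin θ) kˣ) (i : Fin θ) (t : T k θ) :
    comul q (x k i * t) = braidedMul q (x k i ⊗ₜ[k] 1 + 1 ⊗ₜ[k] x k i) (comul q t) := by
  simp [comul]

theorem antipode_one (q : Matrix (Fin θ) (Fin θ) kˣ) : antipode q (1 : T k θ) = 1 := by
  simp [antipode]

theorem antipode_x_mul (q : Matrix (Fin θ) (Fin θ) kˣ) (i : Fin θ) (t : T k θ) :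
    antipode q (x k i * t) = -(act q (Pi.single i 1) (antipode q t) * x k i) := by
  simp [antipode]

/-- The homogeneous component of degree `γ` of `T(V) ⊗ T(V)`, for the total `ℕ^θ`-degree. -/
def homPart₂ (k : Type*) [Field k] {θ : ℕ} (γ : Fin θ →₀ ℕ) : Submodule k (T k θ ⊗[k] T k θ) :=
  Submodule.span k ((fun w : FreeMonoid (Fin θ) × FreeMonoid (Fin θ) =>
    wordBasis k θ w.1 ⊗ₜ[k] wordBasis k θ w.2) '' {w | wordDeg (w.1 * w.2) = γ})

theorem comul_wordBasis_mem (q : Matrix (Fin θ) (Fin θ) kˣ) (w : FreeMonoid (Fin θ)) :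
    comul q (wordBasis k θ w) ∈ homPart₂ k (wordDeg w) := by
  induction w using FreeMonoid.inductionOn' with
  | one =>
    rw [wordBasis_one, comul_one]
    exact Submodule.subset_span ⟨(1, 1), by simp, by simp [wordBasis_one]⟩
  | of_mul i w ih =>
    rw [wordBasis_mul, wordBasis_of, comul_x_mul]
    refine (Submodule.span_le (p := (homPart₂ k _).comap _)).2 ?_ ih
    rintro _ ⟨⟨u, v⟩, huv, rfl⟩
    rw [SetLike.mem_coe, Submodule.mem_comap, braidedMul_primitive]
    simp only [Set.mem_ofPred_eq] at huv
    refine add_mem (Submodule.subset_span ⟨(FreeMonoid.of i * u, v), ?_, rfl⟩)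
      (Submodule.smul_mem _ _ (Submodule.subset_span ⟨(u, FreeMonoid.of i * v), ?_, rfl⟩))
    · simp only [Set.mem_ofPred_eq, mul_assoc, wordDeg_mul (FreeMonoid.of i), huv]
    · simp only [Set.mem_ofPred_eq, wordDeg_mul, ← huv, add_left_comm]

theorem antipode_wordBasis_mem (q : Matrix (Fin θ) (Fin θ) kˣ) (w : FreeMonoid (Fin θ)) :
    antipode q (wordBasis k θ w) ∈ homPart k (wordDeg w) := by
  induction w using FreeMonoid.inductionOn' with
  | one =>
    rw [wordBasis_one, antipode_one, ← wordBasis_one]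
    exact wordBasis_mem_homPart 1
  | of_mul i w ih =>
    rw [wordBasis_mul, wordBasis_of, antipode_x_mul, act_of_mem _ ih, smul_mul_assoc]
    refine neg_mem (Submodule.smul_mem _ _ ?_)
    refine (Submodule.span_le
      (p := (homPart k _).comap (LinearMap.mulRight k (x k i)))).2 ?_ ih
    rintro _ ⟨u, hu, rfl⟩
    rw [SetLike.mem_coe, Submodule.mem_comap, LinearMap.mulRight_apply, ← wordBasis_of,
      ← wordBasis_mul]
    refine Submodule.subset_span ⟨_, ?_, rfl⟩
    rw [Set.mem_ofPred_eq, wordDeg_mul, wordDeg_mul, hu, add_comm]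

/-! ### Twisting the tensor algebra -/

/-- The scalar by which the product of the letters of a word in the twisted algebra differs from
the word itself: the product of the `σ(α_{i_a}, α_{i_b})` over the positions `a < b`. -/
def wordCoeff (q p : Matrix (Fin θ) (Fin θ) kˣ) (w : FreeMonoid (Fin θ)) : kˣ :=
  FreeMonoid.recOn w 1 fun i w c =>
    twistCocycle q p (toZ (wordDeg (FreeMonoid.of i))) (toZ (wordDeg w)) * c

theorem wordCoeff_one (q p : Matrix (Fin θ) (Fin θ) kˣ) : wordCoeff q p 1 = 1 := rfl

theorem wordCoeff_of_mul (q p : Matrix (Fin θ) (Fin θ) kˣ) (i : Fin θ)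
    (w : FreeMonoid (Fin θ)) :
    wordCoeff q p (FreeMonoid.of i * w) =
      twistCocycle q p (toZ (wordDeg (FreeMonoid.of i))) (toZ (wordDeg w)) * wordCoeff q p w :=
  rfl

theorem wordCoeff_mul (q p : Matrix (Fin θ) (Fin θ) kˣ) (u v : FreeMonoid (Fin θ)) :
    wordCoeff q p (u * v) =
      twistCocycle q p (toZ (wordDeg u)) (toZ (wordDeg v)) *
        (wordCoeff q p u * wordCoeff q p v) := by
  induction u using FreeMonoid.inductionOn' with
  | one => simp [wordDeg_one, toZ_zero, twistCocycle_zero_left, wordCoeff_one]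
  | of_mul i u ih =>
    rw [mul_assoc, wordCoeff_of_mul, wordCoeff_of_mul, ih, wordDeg_mul u, wordDeg_mul _ u,
      toZ_add, toZ_add, twistCocycle_add_left, twistCocycle_add_right]
    simp only [mul_comm, mul_left_comm]

theorem wordCoeff_of (q p : Matrix (Fin θ) (Fin θ) kˣ) (i : Fin θ) :
    wordCoeff q p (FreeMonoid.of i) = 1 := by
  rw [← mul_one (FreeMonoid.of i), wordCoeff_of_mul, wordDeg_one, toZ_zero,
    twistCocycle_zero_right, wordCoeff_one, one_mul]

theorem wordCoeff_swap (q p : Matrix (Fin θ) (Fin θ) kˣ) (w : FreeMonoid (Fin θ)) :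
    wordCoeff p q w = (wordCoeff q p w)⁻¹ := by
  induction w using FreeMonoid.inductionOn' with
  | one => simp [wordCoeff_one]
  | of_mul i w ih => rw [wordCoeff_of_mul, wordCoeff_of_mul, ih, twistCocycle_swap, mul_inv]

/-- The linear automorphism of the vector space `T(V)` that sends a product of generators to their
product in the twisted algebra. -/
def twist (q p : Matrix (Fin θ) (Fin θ) kˣ) : T k θ ≃ₗ[k] T k θ :=
  (wordBasis k θ).equiv ((wordBasis k θ).unitsSMul (wordCoeff q p)) (Equiv.refl _)

theorem twist_wordBasis (q p : Matrix (Fin θ) (Fin θ) kˣ) (w : FreeMonoid (Fin θ)) :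
    twist q p (wordBasis k θ w) = (wordCoeff q p w : k) • wordBasis k θ w := by
  rw [twist, Module.Basis.equiv_apply, Module.Basis.unitsSMul_apply]
  rfl

theorem twist_symm (q p : Matrix (Fin θ) (Fin θ) kˣ) : (twist q p).symm = twist p q := by
  refine LinearEquiv.toLinearMap_injective ((wordBasis k θ).ext fun w => ?_)
  rw [LinearEquiv.coe_coe, LinearEquiv.coe_coe, LinearEquiv.symm_apply_eq, twist_wordBasis,
    map_smul, twist_wordBasis, smul_smul, wordCoeff_swap q p, ← Units.val_mul, inv_mul_cancel,
    Units.val_one, one_smul]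

theorem twist_one (q p : Matrix (Fin θ) (Fin θ) kˣ) : twist q p (1 : T k θ) = 1 := by
  rw [← wordBasis_one, twist_wordBasis, wordCoeff_one, Units.val_one, one_smul]

theorem twist_x (q p : Matrix (Fin θ) (Fin θ) kˣ) (i : Fin θ) : twist q p (x k i) = x k i := by
  rw [← wordBasis_of, twist_wordBasis, wordCoeff_of, Units.val_one, one_smul]

theorem map_twist_homPart_le (q p : Matrix (Fin θ) (Fin θ) kˣ) (α : Fin θ →₀ ℕ) :
    (homPart k α).map (twist q p).toLinearMap ≤ homPart k α := by
  rw [homPart, Submodule.map_span_le]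
  rintro _ ⟨w, rfl, rfl⟩
  rw [LinearEquiv.coe_coe, twist_wordBasis]
  exact Submodule.smul_mem _ _ (wordBasis_mem_homPart w)

theorem twist_mem_homPart (q p : Matrix (Fin θ) (Fin θ) kˣ) {α : Fin θ →₀ ℕ} {t : T k θ}
    (ht : t ∈ homPart k α) : twist q p t ∈ homPart k α :=
  map_twist_homPart_le q p α (Submodule.mem_map_of_mem ht)

theorem map_twist_homPart (q p : Matrix (Fin θ) (Fin θ) kˣ) (α : Fin θ →₀ ℕ) :
    (homPart k α).map (twist q p).toLinearMap = homPart k α := by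
  refine le_antisymm (map_twist_homPart_le q p α) fun t ht => ⟨twist p q t, ?_, ?_⟩
  · exact twist_mem_homPart p q ht
  · rw [← twist_symm q p, LinearEquiv.coe_coe, LinearEquiv.apply_symm_apply]

theorem twist_mul (q p : Matrix (Fin θ) (Fin θ) kˣ) {β γ : Fin θ →₀ ℕ} {s t : T k θ}
    (hs : s ∈ homPart k β) (ht : t ∈ homPart k γ) :
    twist q p (s * t) =
      (twistCocycle q p (toZ β) (toZ γ) : k) • (twist q p s * twist q p t) := by
  induction hs, ht using Submodule.span_induction₂ with
  | mem_mem s t hs ht =>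
    obtain ⟨u, rfl, rfl⟩ := hs
    obtain ⟨v, rfl, rfl⟩ := ht
    rw [← wordBasis_mul, twist_wordBasis, twist_wordBasis, twist_wordBasis, wordCoeff_mul,
      smul_mul_smul_comm, ← wordBasis_mul, smul_smul, Units.val_mul, Units.val_mul]
  | zero_left => simp
  | zero_right => simp
  | add_left s s' t _ _ _ h h' => simp only [add_mul, map_add, h, h', smul_add]
  | add_right s t t' _ _ _ h h' => simp only [mul_add, map_add, h, h', smul_add]
  | smul_left c s t _ _ h => rw [smul_mul_assoc, map_smul, map_smul, h, smul_mul_assoc, smul_comm]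
  | smul_right c s t _ _ h => rw [mul_smul_comm, map_smul, map_smul, h, mul_smul_comm, smul_comm]

theorem counit_twist (q p : Matrix (Fin θ) (Fin θ) kˣ) (t : T k θ) :
    counit k θ (twist q p t) = counit k θ t := by
  have h : (counit k θ).toLinearMap ∘ₗ (twist q p).toLinearMap = (counit k θ).toLinearMap := by
    refine (wordBasis k θ).ext fun w => ?_
    rw [LinearMap.comp_apply, LinearEquiv.coe_coe, twist_wordBasis, map_smul]
    -- The counit kills all words but the empty one, whose coefficient is `1`.
    induction w using FreeMonoid.casesOn with
    | one => rw [wordCoeff_one, Units.val_one, one_smul]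
    | of_mul i w => simp [wordBasis_mul, wordBasis_of, counit]
  exact LinearMap.congr_fun h t

theorem TwistEquiv.antipode_twist {q p : Matrix (Fin θ) (Fin θ) kˣ} (h : TwistEquiv q p)
    (t : T k θ) : antipode q (twist q p t) = twist q p (antipode p t) := by
  have h' : antipode q ∘ₗ (twist q p).toLinearMap =
      (twist q p).toLinearMap ∘ₗ antipode p := by
    refine (wordBasis k θ).ext fun w => ?_
    simp only [LinearMap.comp_apply, LinearEquiv.coe_coe]
    induction w using FreeMonoid.inductionOn' with
    | one => rw [wordBasis_one, twist_one, antipode_one, antipode_one, twist_one]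
    | of_mul i w ih =>
      have hi : x k i ∈ homPart k (wordDeg (FreeMonoid.of i)) := by
        rw [← wordBasis_of]; exact wordBasis_mem_homPart _
      have hw := antipode_wordBasis_mem (k := k) p w
      rw [wordBasis_mul, wordBasis_of, antipode_x_mul, act_of_mem _ hw,
        twist_mul q p hi (wordBasis_mem_homPart w), map_smul, twist_x, antipode_x_mul, ih,
        act_of_mem _ (twist_mem_homPart q p hw), map_neg, smul_mul_assoc, smul_mul_assoc, map_smul,
        twist_mul q p hw hi, twist_x, smul_neg, smul_smul, smul_smul, wordDeg_of,
        toZ_single, ← Units.val_mul, ← Units.val_mul, h.bichar_mul]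
  exact LinearMap.congr_fun h' t

/-- The operator `D` on `T(V) ⊗ T(V)` that multiplies the component of bidegree `(β, γ)` by
`σ(β, γ)⁻¹`. -/
def scale (q p : Matrix (Fin θ) (Fin θ) kˣ) : T k θ ⊗[k] T k θ →ₗ[k] T k θ ⊗[k] T k θ :=
  ((wordBasis k θ).tensorProduct (wordBasis k θ)).constr k fun w =>
    ((twistCocycle q p (toZ (wordDeg w.1)) (toZ (wordDeg w.2)))⁻¹ : kˣ).val •
      wordBasis k θ w.1 ⊗ₜ[k] wordBasis k θ w.2

theorem scale_wordBasis (q p : Matrix (Fin θ) (Fin θ) kˣ) (u v : FreeMonoid (Fin θ)) :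
    scale q p (wordBasis k θ u ⊗ₜ[k] wordBasis k θ v) =
      ((twistCocycle q p (toZ (wordDeg u)) (toZ (wordDeg v)))⁻¹ : kˣ).val •
        wordBasis k θ u ⊗ₜ[k] wordBasis k θ v := by
  rw [scale, ← Module.Basis.tensorProduct_apply, Module.Basis.constr_basis]
  simp

theorem scale_tmul (q p : Matrix (Fin θ) (Fin θ) kˣ) {β γ : Fin θ →₀ ℕ} {s t : T k θ}
    (hs : s ∈ homPart k β) (ht : t ∈ homPart k γ) :
    scale q p (s ⊗ₜ[k] t) =
      ((twistCocycle q p (toZ β) (toZ γ))⁻¹ : kˣ).val • (s ⊗ₜ[k] t) := by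
  induction hs, ht using Submodule.span_induction₂ with
  | mem_mem s t hs ht =>
    obtain ⟨u, rfl, rfl⟩ := hs
    obtain ⟨v, rfl, rfl⟩ := ht
    exact scale_wordBasis q p u v
  | zero_left => simp
  | zero_right => simp
  | add_left s s' t _ _ _ h h' => simp only [TensorProduct.add_tmul, map_add, h, h', smul_add]
  | add_right s t t' _ _ _ h h' => simp only [TensorProduct.tmul_add, map_add, h, h', smul_add]
  | smul_left c s t _ _ h => rw [← TensorProduct.smul_tmul', map_smul, h, smul_comm]
  | smul_right c s t _ _ h => rw [TensorProduct.tmul_smul, map_smul, h, smul_comm]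

/-- The operator `D⁻¹ (e ⊗ e)` on `T(V) ⊗ T(V)`, where `e` is `twist q p` and `D` is `scale q p`.
On a pair of words it is the scalar by which `e` acts on the concatenated word. -/
def twist₂ (q p : Matrix (Fin θ) (Fin θ) kˣ) : T k θ ⊗[k] T k θ →ₗ[k] T k θ ⊗[k] T k θ :=
  ((wordBasis k θ).tensorProduct (wordBasis k θ)).constr k fun w =>
    (wordCoeff q p (w.1 * w.2) : k) • wordBasis k θ w.1 ⊗ₜ[k] wordBasis k θ w.2

theorem twist₂_wordBasis (q p : Matrix (Fin θ) (Fin θ) kˣ) (u v : FreeMonoid (Fin θ)) :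
    twist₂ q p (wordBasis k θ u ⊗ₜ[k] wordBasis k θ v) =
      (wordCoeff q p (u * v) : k) • wordBasis k θ u ⊗ₜ[k] wordBasis k θ v := by
  rw [twist₂, ← Module.Basis.tensorProduct_apply, Module.Basis.constr_basis]
  simp

theorem scale_comp_twist₂ (q p : Matrix (Fin θ) (Fin θ) kˣ) :
    scale q p ∘ₗ twist₂ q p =
      TensorProduct.map (twist q p : T k θ →ₗ[k] T k θ) (twist q p).toLinearMap := by
  refine ((wordBasis k θ).tensorProduct (wordBasis k θ)).ext fun ⟨u, v⟩ => ?_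
  rw [Module.Basis.tensorProduct_apply, LinearMap.comp_apply, twist₂_wordBasis, map_smul,
    scale_wordBasis, TensorProduct.map_tmul, LinearEquiv.coe_coe, twist_wordBasis,
    twist_wordBasis, TensorProduct.smul_tmul_smul, smul_smul, wordCoeff_mul, ← Units.val_mul,
    mul_comm, inv_mul_cancel_left, Units.val_mul]

/-- Up to a scalar depending only on the total degree, the contribution of `x_i` to the coproduct
is intertwined by `twist₂`. -/
theorem TwistEquiv.twist₂_braidedMul {q p : Matrix (Fin θ) (Fin θ) kˣ} (h : TwistEquiv q p)
    (i : Fin θ) {γ : Fin θ →₀ ℕ} {y : T k θ ⊗[k] T k θ} (hy : y ∈ homPart₂ k γ) :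
    twist₂ q p (braidedMul p (x k i ⊗ₜ[k] 1 + 1 ⊗ₜ[k] x k i) y) =
      (twistCocycle q p (toZ (wordDeg (FreeMonoid.of i))) (toZ γ) : k) •
        braidedMul q (x k i ⊗ₜ[k] 1 + 1 ⊗ₜ[k] x k i) (twist₂ q p y) := by
  induction hy using Submodule.span_induction with
  | mem y hy =>
    obtain ⟨⟨u, v⟩, rfl, rfl⟩ := hy
    have key := h.bichar_mul (toZ (wordDeg (FreeMonoid.of i))) (toZ (wordDeg u))
    have hc : bichar p (toZ (wordDeg (FreeMonoid.of i))) (toZ (wordDeg u)) *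
        wordCoeff q p (u * (FreeMonoid.of i * v)) =
        twistCocycle q p (toZ (wordDeg (FreeMonoid.of i))) (toZ (wordDeg (u * v))) *
          (wordCoeff q p (u * v) *
            bichar q (toZ (wordDeg (FreeMonoid.of i))) (toZ (wordDeg u))) := by
      rw [wordCoeff_mul _ _ u, wordCoeff_of_mul, wordCoeff_mul _ _ u, wordDeg_mul _ v, wordDeg_mul u,
        toZ_add, toZ_add, twistCocycle_add_right, twistCocycle_add_right]
      calc _ = (bichar p (toZ (wordDeg (FreeMonoid.of i))) (toZ (wordDeg u)) *
            twistCocycle q p (toZ (wordDeg u)) (toZ (wordDeg (FreeMonoid.of i)))) *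
            (twistCocycle q p (toZ (wordDeg u)) (toZ (wordDeg v)) * (wordCoeff q p u *
              (twistCocycle q p (toZ (wordDeg (FreeMonoid.of i))) (toZ (wordDeg v)) *
                wordCoeff q p v))) := by simp only [mul_comm, mul_left_comm]
        _ = _ := by rw [key]; simp only [mul_comm, mul_left_comm]
    dsimp only
    rw [braidedMul_primitive, map_add, map_smul, twist₂_wordBasis, twist₂_wordBasis,
      twist₂_wordBasis, map_smul, braidedMul_primitive, smul_add, smul_add, smul_smul, smul_smul,
      smul_smul, smul_smul, mul_assoc, wordCoeff_of_mul, ← Units.val_mul, ← Units.val_mul, hc,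
      Units.val_mul, Units.val_mul, Units.val_mul, mul_assoc]
  | zero => simp
  | add y z _ _ hy hz =>
    rw [map_add (braidedMul p _), map_add (twist₂ q p), map_add (twist₂ q p), hy, hz,
      map_add (braidedMul q _), smul_add]
  | smul c y _ hy => rw [map_smul, map_smul, hy, map_smul, map_smul, smul_comm]

theorem TwistEquiv.twist₂_comul {q p : Matrix (Fin θ) (Fin θ) kˣ} (h : TwistEquiv q p)
    (t : T k θ) : twist₂ q p (comul p t) = comul q (twist q p t) := by
  have h' : twist₂ q p ∘ₗ comul p = comul q ∘ₗ (twist q p).toLinearMap := by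
    refine (wordBasis k θ).ext fun w => ?_
    simp only [LinearMap.comp_apply, LinearEquiv.coe_coe]
    induction w using FreeMonoid.inductionOn' with
    | one =>
      rw [wordBasis_one, twist_one, comul_one, comul_one, ← wordBasis_one, twist₂_wordBasis,
        mul_one, wordCoeff_one, Units.val_one, one_smul]
    | of_mul i w ih =>
      have hi : x k i ∈ homPart k (wordDeg (FreeMonoid.of i)) := by
        rw [← wordBasis_of]; exact wordBasis_mem_homPart _
      rw [wordBasis_mul, wordBasis_of, comul_x_mul,
        h.twist₂_braidedMul i (comul_wordBasis_mem p w), ih,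
        twist_mul q p hi (wordBasis_mem_homPart w), twist_x, map_smul, comul_x_mul]
  exact LinearMap.congr_fun h' t

/-- The twisting map intertwines the coproduct of `T(V)` for `p` with the twisted coproduct of
`T(V)` for `q`. -/
theorem TwistEquiv.map_twist_comul {q p : Matrix (Fin θ) (Fin θ) kˣ} (h : TwistEquiv q p)
    (t : T k θ) :
    TensorProduct.map (twist q p).toLinearMap (twist q p).toLinearMap (comul p t) =
      scale q p (comul q (twist q p t)) := by
  rw [← scale_comp_twist₂, LinearMap.comp_apply, h.twist₂_comul]

/-! ### Twisting pre-Nichols algebras -/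

theorem mem_of_forall_wordBasis {N : Submodule k (T k θ)} (h : ∀ w, wordBasis k θ w ∈ N)
    (t : T k θ) : t ∈ N :=
  Submodule.span_le.2 (Set.range_subset_iff.2 h) ((wordBasis k θ).mem_span t)

theorem map_twist_map_twist (q p : Matrix (Fin θ) (Fin θ) kˣ) (y : T k θ ⊗[k] T k θ) :
    TensorProduct.map (twist p q).toLinearMap (twist p q).toLinearMap
      (TensorProduct.map (twist q p).toLinearMap (twist q p).toLinearMap y) = y := by
  rw [← LinearMap.comp_apply, ← TensorProduct.map_comp, ← twist_symm q p, LinearEquiv.symm_comp,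
    TensorProduct.map_id, LinearMap.id_apply]

theorem ker_map_mkₐ (J : Ideal (T k θ)) [J.IsTwoSided] :
    LinearMap.ker (TensorProduct.map (Ideal.Quotient.mkₐ k J).toLinearMap
      (Ideal.Quotient.mkₐ k J).toLinearMap) =
    LinearMap.range (LinearMap.rTensor (T k θ) (J.restrictScalars k).subtype) ⊔
      LinearMap.range (LinearMap.lTensor (T k θ) (J.restrictScalars k).subtype) := by
  have hex : Function.Exact (J.restrictScalars k).subtype
      (Ideal.Quotient.mkₐ k J).toLinearMap := by
    intro t
    simp [Ideal.Quotient.eq_zero_iff_mem]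
  have hs : Function.Surjective (Ideal.Quotient.mkₐ k J).toLinearMap :=
    Ideal.Quotient.mkₐ_surjective k J
  rw [TensorProduct.map_ker hex hs hex hs, sup_comm]

namespace PreNichols

variable {q p : Matrix (Fin θ) (Fin θ) kˣ}

theorem proj_surjective (B : PreNichols q) : Function.Surjective B.proj :=
  Ideal.Quotient.mkₐ_surjective k B.ideal

theorem proj_eq_zero_iff (B : PreNichols q) {t : T k θ} : B.proj t = 0 ↔ t ∈ B.ideal :=
  Ideal.Quotient.eq_zero_iff_mem

/-- A subspace contains the defining ideal as soon as it contains its homogeneous elements. -/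
theorem ideal_le_of_homogeneous (B : PreNichols q) {N : Submodule k (T k θ)}
    (h : ∀ α, ∀ t ∈ B.ideal, t ∈ homPart k α → t ∈ N) : B.ideal.restrictScalars k ≤ N := by
  rw [B.homogeneous]
  exact iSup_le fun α t ht => h α t ht.1 ht.2

theorem twist_mul_mem_left (B : PreNichols q) (a : T k θ) {t : T k θ}
    (ht : twist q p t ∈ B.ideal) : twist q p (a * t) ∈ B.ideal := by
  refine mem_of_forall_wordBasis (N := (B.ideal.restrictScalars k).comap
    ((twist q p).toLinearMap ∘ₗ LinearMap.mulRight k t)) (fun w => ?_) a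
  have h := B.ideal_le_of_homogeneous (N := (B.ideal.restrictScalars k).comap
    ((twist q p).toLinearMap ∘ₗ LinearMap.mulLeft k (wordBasis k θ w) ∘ₗ
      (twist p q).toLinearMap)) (fun α s hs hα => ?_) ht
  · simpa [← twist_symm q p] using h
  · simp only [Submodule.mem_comap, LinearMap.comp_apply, LinearEquiv.coe_coe,
      LinearMap.mulLeft_apply, Submodule.restrictScalars_mem]
    rw [twist_mul q p (wordBasis_mem_homPart w) (twist_mem_homPart p q hα), ← twist_symm q p,
      LinearEquiv.apply_symm_apply]
    exact (B.ideal.restrictScalars k).smul_mem _ (B.ideal.mul_mem_left _ hs)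

theorem twist_mul_mem_right (B : PreNichols q) (a : T k θ) {t : T k θ}
    (ht : twist q p t ∈ B.ideal) : twist q p (t * a) ∈ B.ideal := by
  refine mem_of_forall_wordBasis (N := (B.ideal.restrictScalars k).comap
    ((twist q p).toLinearMap ∘ₗ LinearMap.mulLeft k t)) (fun w => ?_) a
  have h := B.ideal_le_of_homogeneous (N := (B.ideal.restrictScalars k).comap
    ((twist q p).toLinearMap ∘ₗ LinearMap.mulRight k (wordBasis k θ w) ∘ₗ
      (twist p q).toLinearMap)) (fun α s hs hα => ?_) ht
  · simpa [← twist_symm q p] using h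
  · simp only [Submodule.mem_comap, LinearMap.comp_apply, LinearEquiv.coe_coe,
      LinearMap.mulRight_apply, Submodule.restrictScalars_mem]
    rw [twist_mul q p (twist_mem_homPart p q hα) (wordBasis_mem_homPart w), ← twist_symm q p,
      LinearEquiv.apply_symm_apply]
    exact (B.ideal.restrictScalars k).smul_mem _ (B.ideal.mul_mem_right _ hs)

/-- A linear map that vanishes on `J ⊗ T(V)`, with `J` the defining ideal, vanishes on its image
under `D`. -/
theorem apply_scale_tmul_left (B : PreNichols q) {M : Type*} [AddCommGroup M] [Module k M]
    {F : T k θ ⊗[k] T k θ →ₗ[k] M} (hF : ∀ s ∈ B.ideal, ∀ t, F (s ⊗ₜ[k] t) = 0)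
    {s : T k θ} (hs : s ∈ B.ideal) (t : T k θ) : F (DiagonalType.scale q p (s ⊗ₜ[k] t)) = 0 := by
  have h1 (w : FreeMonoid (Fin θ)) : B.ideal.restrictScalars k ≤
      LinearMap.ker ((F ∘ₗ DiagonalType.scale q p) ∘ₗ
        (TensorProduct.mk k (T k θ) (T k θ)).flip (wordBasis k θ w)) := by
    refine B.ideal_le_of_homogeneous fun α s hs hα => ?_
    change F (DiagonalType.scale q p (s ⊗ₜ[k] wordBasis k θ w)) = 0
    rw [scale_tmul q p hα (wordBasis_mem_homPart w), map_smul, hF s hs, smul_zero]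
  have h2 : t ∈ LinearMap.ker
      ((F ∘ₗ DiagonalType.scale q p) ∘ₗ TensorProduct.mk k (T k θ) (T k θ) s) :=
    mem_of_forall_wordBasis (fun w => h1 w hs) t
  exact h2

theorem apply_scale_tmul_right (B : PreNichols q) {M : Type*} [AddCommGroup M] [Module k M]
    {F : T k θ ⊗[k] T k θ →ₗ[k] M} (hF : ∀ s, ∀ t ∈ B.ideal, F (s ⊗ₜ[k] t) = 0)
    (s : T k θ) {t : T k θ} (ht : t ∈ B.ideal) : F (DiagonalType.scale q p (s ⊗ₜ[k] t)) = 0 := by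
  have h1 (w : FreeMonoid (Fin θ)) : B.ideal.restrictScalars k ≤
      LinearMap.ker ((F ∘ₗ DiagonalType.scale q p) ∘ₗ
        TensorProduct.mk k (T k θ) (T k θ) (wordBasis k θ w)) := by
    refine B.ideal_le_of_homogeneous fun α t ht hα => ?_
    change F (DiagonalType.scale q p (wordBasis k θ w ⊗ₜ[k] t)) = 0
    rw [scale_tmul q p (wordBasis_mem_homPart w) hα, map_smul, hF _ t ht, smul_zero]
  have h2 : s ∈ LinearMap.ker
      ((F ∘ₗ DiagonalType.scale q p) ∘ₗ (TensorProduct.mk k (T k θ) (T k θ)).flip t) :=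
    mem_of_forall_wordBasis (fun w => h1 w ht) s
  exact h2

/-- The operator `D` on `T(V) ⊗ T(V)` preserves the kernel of the projection to `B ⊗ B`, because the
defining ideal of `B` is homogeneous. -/
theorem map_proj_scale_eq_zero (B : PreNichols q) {y : T k θ ⊗[k] T k θ}
    (hy : TensorProduct.map B.proj.toLinearMap B.proj.toLinearMap y = 0) :
    TensorProduct.map B.proj.toLinearMap B.proj.toLinearMap (DiagonalType.scale q p y) = 0 := by
  rw [← LinearMap.mem_ker, ker_map_mkₐ] at hy
  refine (sup_le ?_ ?_ : _ ≤ LinearMap.ker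
    (TensorProduct.map B.proj.toLinearMap B.proj.toLinearMap ∘ₗ DiagonalType.scale q p)) hy
  · rw [LinearMap.range_le_ker_iff]
    refine TensorProduct.ext' fun s t => B.apply_scale_tmul_left (q := q) (p := p)
      (F := TensorProduct.map B.proj.toLinearMap B.proj.toLinearMap) (fun s hs t => ?_) s.2 t
    have h0 : B.proj.toLinearMap s = 0 := B.proj_eq_zero_iff.2 hs
    rw [TensorProduct.map_tmul, h0, TensorProduct.zero_tmul]
  · rw [LinearMap.range_le_ker_iff]
    refine TensorProduct.ext' fun s t => B.apply_scale_tmul_right (q := q) (p := p)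
      (F := TensorProduct.map B.proj.toLinearMap B.proj.toLinearMap) (fun s t ht => ?_) s t.2
    have h0 : B.proj.toLinearMap t = 0 := B.proj_eq_zero_iff.2 ht
    rw [TensorProduct.map_tmul, h0, TensorProduct.tmul_zero]

theorem map_proj_comul_eq_zero (B : PreNichols q) {t : T k θ} (ht : t ∈ B.ideal) :
    TensorProduct.map B.proj.toLinearMap B.proj.toLinearMap (DiagonalType.comul q t) = 0 := by
  rw [← LinearMap.mem_ker, ker_map_mkₐ]
  exact B.isHopfIdeal.comul_mem t ht

/-- The preimage of the defining ideal of a pre-Nichols algebra under the twisting map. -/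
def twistIdeal (p : Matrix (Fin θ) (Fin θ) kˣ) (B : PreNichols q) : Ideal (T k θ) where
  __ := (B.ideal.restrictScalars k).comap (twist q p).toLinearMap
  smul_mem' a _ ht := B.twist_mul_mem_left a ht

theorem mem_twistIdeal {B : PreNichols q} {t : T k θ} :
    t ∈ B.twistIdeal p ↔ twist q p t ∈ B.ideal := Iff.rfl

theorem twistIdeal_restrictScalars (B : PreNichols q) :
    (B.twistIdeal p).restrictScalars k =
      (B.ideal.restrictScalars k).map (twist p q).toLinearMap := by
  ext t
  constructor
  · intro ht
    refine ⟨twist q p t, ht, ?_⟩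
    rw [← twist_symm q p, LinearEquiv.coe_coe, LinearEquiv.symm_apply_apply]
  · rintro ⟨s, hs, rfl⟩
    rw [Submodule.restrictScalars_mem, mem_twistIdeal, ← twist_symm q p, LinearEquiv.coe_coe,
      LinearEquiv.apply_symm_apply]
    exact hs

/-- The cocycle twist of a pre-Nichols algebra, presented as a quotient of `T(V)`. -/
def twisted (h : TwistEquiv q p) (B : PreNichols q) : PreNichols p where
  ideal := B.twistIdeal p
  isHopfIdeal :=
    { isTwoSided := ⟨fun a ht => B.twist_mul_mem_right a ht⟩
      comul_mem := fun t ht => by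
        have hmem (s : B.ideal.restrictScalars k) :
            twist p q (s : T k θ) ∈ (B.twistIdeal p).restrictScalars k := by
          rw [twistIdeal_restrictScalars]
          exact Submodule.mem_map_of_mem s.2
        have h0 := B.map_proj_scale_eq_zero (p := p)
          (B.map_proj_comul_eq_zero (mem_twistIdeal.1 ht))
        rw [← h.map_twist_comul, ← LinearMap.mem_ker, ker_map_mkₐ] at h0
        have h1 := Submodule.mem_map_of_mem
          (f := TensorProduct.map (twist p q).toLinearMap (twist p q).toLinearMap) h0
        rw [map_twist_map_twist, Submodule.map_sup] at h1
        refine SetLike.le_def.1 (sup_le_sup ?_ ?_) h1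
        · rintro _ ⟨_, ⟨y, rfl⟩, rfl⟩
          induction y with
          | zero => simp
          | add y z hy hz => rw [map_add, map_add]; exact add_mem hy hz
          | tmul s t => exact ⟨⟨twist p q s, hmem s⟩ ⊗ₜ twist p q t, rfl⟩
        · rintro _ ⟨_, ⟨y, rfl⟩, rfl⟩
          induction y with
          | zero => simp
          | add y z hy hz => rw [map_add, map_add]; exact add_mem hy hz
          | tmul s t => exact ⟨twist p q s ⊗ₜ ⟨twist p q t, hmem t⟩, rfl⟩
      counit_eq_zero := fun t ht => by
        rw [← counit_twist q p]
        exact B.isHopfIdeal.counit_eq_zero _ ht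
      antipode_mem := fun t ht => by
        rw [mem_twistIdeal, ← h.antipode_twist]
        exact B.isHopfIdeal.antipode_mem _ ht }
  homogeneous := by
    rw [twistIdeal_restrictScalars]
    conv_lhs => rw [B.homogeneous, Submodule.map_iSup]
    refine iSup_congr fun α => ?_
    rw [Submodule.map_inf _ (twist p q).injective, map_twist_homPart]

theorem mem_twisted_ideal {h : TwistEquiv q p} {B : PreNichols q} {t : T k θ} :
    t ∈ (B.twisted h).ideal ↔ twist q p t ∈ B.ideal := Iff.rfl

theorem twisted_twisted (h : TwistEquiv q p) (B : PreNichols q) :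
    (B.twisted h).twisted h.symm = B := by
  have e (t : T k θ) : t ∈ ((B.twisted h).twisted h.symm).ideal ↔ t ∈ B.ideal := by
    rw [mem_twisted_ideal, mem_twisted_ideal, ← twist_symm q p, LinearEquiv.apply_symm_apply]
  exact le_antisymm ((le_iff _ _).2 fun t => (e t).1) ((le_iff _ _).2 fun t => (e t).2)

theorem twisted_le_twisted (h : TwistEquiv q p) {B₁ B₂ : PreNichols q} (hB : B₁ ≤ B₂) :
    B₁.twisted h ≤ B₂.twisted h :=
  (le_iff _ _).2 fun _ ht => (le_iff _ _).1 hB ht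

/-- Twisting is an isomorphism of posets, inverse to twisting in the opposite direction. -/
def twistOrderIso (h : TwistEquiv q p) : PreNichols q ≃o PreNichols p where
  toFun := twisted h
  invFun := twisted h.symm
  left_inv := twisted_twisted h
  right_inv := twisted_twisted h.symm
  map_rel_iff' {B₁ B₂} := by
    refine ⟨fun hB => ?_, twisted_le_twisted h⟩
    have := twisted_le_twisted h.symm hB
    rwa [Equiv.coe_fn_mk, twisted_twisted, twisted_twisted] at this

theorem map_twisted_ideal (h : TwistEquiv q p) (B : PreNichols q) :
    ((B.twisted h).ideal.restrictScalars k).map (twist q p).toLinearMap =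
      B.ideal.restrictScalars k := by
  conv_rhs => rw [← twisted_twisted h B]
  exact ((B.twisted h).twistIdeal_restrictScalars (p := q)).symm

/-- The linear isomorphism from a twisted pre-Nichols algebra to the original one induced by the
twisting map of `T(V)`. -/
def twistedEquiv (h : TwistEquiv q p) (B : PreNichols q) : (B.twisted h).Alg ≃ₗ[k] B.Alg :=
  (Submodule.Quotient.restrictScalarsEquiv k (B.twisted h).ideal).symm ≪≫ₗ
    Submodule.Quotient.equiv ((B.twisted h).ideal.restrictScalars k)
      (B.ideal.restrictScalars k) (twist q p)
      (B.map_twisted_ideal h) ≪≫ₗ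
    Submodule.Quotient.restrictScalarsEquiv k B.ideal

theorem twistedEquiv_proj (h : TwistEquiv q p) (B : PreNichols q) (t : T k θ) :
    B.twistedEquiv h ((B.twisted h).proj t) = B.proj (twist q p t) := rfl

theorem map_twistedEquiv_gr (h : TwistEquiv q p) (B : PreNichols q) (α : Fin θ →₀ ℕ) :
    ((B.twisted h).gr α).map (B.twistedEquiv h).toLinearMap = B.gr α := by
  have hc : (B.twistedEquiv h).toLinearMap ∘ₗ (B.twisted h).proj.toLinearMap =
      B.proj.toLinearMap ∘ₗ (twist q p).toLinearMap := rfl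
  rw [gr, gr, ← Submodule.map_comp, hc, Submodule.map_comp, map_twist_homPart]

theorem hilbertSeries_twisted (h : TwistEquiv q p) (B : PreNichols q) :
    (B.twisted h).hilbertSeries = B.hilbertSeries := by
  funext α
  rw [hilbertSeries, hilbertSeries, ← map_twistedEquiv_gr h B α]
  exact (LinearEquiv.finrank_map_eq (B.twistedEquiv h) _).symm

/-- The operator `D` on `B ⊗ B` that multiplies the component of bidegree `(β, γ)` by
`σ(β, γ)⁻¹`. -/
def scale (p : Matrix (Fin θ) (Fin θ) kˣ) (B : PreNichols q) :
    B.Alg ⊗[k] B.Alg →ₗ[k] B.Alg ⊗[k] B.Alg :=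
  (LinearMap.ker (TensorProduct.map B.proj.toLinearMap B.proj.toLinearMap)).liftQ
      (TensorProduct.map B.proj.toLinearMap B.proj.toLinearMap ∘ₗ DiagonalType.scale q p)
      (fun _ hy => B.map_proj_scale_eq_zero hy) ∘ₗ
    ((TensorProduct.map B.proj.toLinearMap B.proj.toLinearMap).quotKerEquivOfSurjective
      (TensorProduct.map_surjective B.proj_surjective B.proj_surjective)).symm.toLinearMap

theorem scale_map_proj (B : PreNichols q) (y : T k θ ⊗[k] T k θ) :
    B.scale p (TensorProduct.map B.proj.toLinearMap B.proj.toLinearMap y) =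
      TensorProduct.map B.proj.toLinearMap B.proj.toLinearMap (DiagonalType.scale q p y) := by
  rw [scale, LinearMap.comp_apply, LinearEquiv.coe_coe,
    LinearMap.quotKerEquivOfSurjective_symm_apply]
  rfl

theorem isCocycleTwist_twisted (h : TwistEquiv q p) (B : PreNichols q) :
    IsCocycleTwist (twistCocycle q p) B (B.twisted h) := by
  refine ⟨B.twistedEquiv h, B.scale p, ?_, fun i => ?_, map_twistedEquiv_gr h B, ?_, ?_, ?_⟩
  · rw [← map_one (B.twisted h).proj, twistedEquiv_proj, twist_one, map_one]
  · rw [twistedEquiv_proj, twist_x]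
  · rintro β γ _ ⟨s, hs, rfl⟩ _ ⟨t, ht, rfl⟩
    simp only [AlgHom.toLinearMap_apply]
    rw [← map_mul, twistedEquiv_proj, twistedEquiv_proj, twistedEquiv_proj, twist_mul q p hs ht,
      map_smul, map_mul]
  · rintro β γ _ ⟨s, hs, rfl⟩ _ ⟨t, ht, rfl⟩
    rw [← TensorProduct.map_tmul, scale_map_proj, scale_tmul q p hs ht, map_smul]
  · intro b
    obtain ⟨t, rfl⟩ := (B.twisted h).proj_surjective b
    rw [twistedEquiv_proj, comul_proj, comul_proj, scale_map_proj, ← h.map_twist_comul,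
      ← LinearMap.comp_apply (TensorProduct.map _ _) (TensorProduct.map _ _),
      ← LinearMap.comp_apply (TensorProduct.map _ _) (TensorProduct.map _ _),
      ← TensorProduct.map_comp, ← TensorProduct.map_comp]
    rfl

/-! ### Gelfand-Kirillov dimension of twists -/

open scoped Pointwise

/-- The span of the images of a set of words in a pre-Nichols algebra. -/
def wordSpan (B : PreNichols q) (F : Set (FreeMonoid (Fin θ))) : Submodule k B.Alg :=
  Submodule.span k ((fun w => B.proj (wordBasis k θ w)) '' F)

theorem wordSpan_pow (B : PreNichols q) (F : Set (FreeMonoid (Fin θ))) (n : ℕ) :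
    B.wordSpan F ^ n = B.wordSpan (F ^ n) := by
  let f : FreeMonoid (Fin θ) →* B.Alg :=
    { toFun := fun w => B.proj (wordBasis k θ w)
      map_one' := by rw [wordBasis_one, map_one]
      map_mul' := fun u v => by rw [wordBasis_mul, map_mul] }
  change Submodule.span k (f '' F) ^ n = Submodule.span k (f '' (F ^ n))
  rw [Submodule.span_pow, Set.image_pow]

theorem map_twistedEquiv_wordSpan_le (h : TwistEquiv q p) (B : PreNichols q)
    (F : Set (FreeMonoid (Fin θ))) :
    ((B.twisted h).wordSpan F).map (B.twistedEquiv h).toLinearMap ≤ B.wordSpan F := by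
  rw [wordSpan, Submodule.map_span_le]
  rintro _ ⟨w, hw, rfl⟩
  rw [LinearEquiv.coe_coe, twistedEquiv_proj, twist_wordBasis, map_smul]
  exact Submodule.smul_mem _ _ (Submodule.subset_span ⟨w, hw, rfl⟩)

theorem exists_finite_le_wordSpan (B : PreNichols q) (V : Submodule k B.Alg)
    [FiniteDimensional k V] : ∃ F : Set (FreeMonoid (Fin θ)), F.Finite ∧ V ≤ B.wordSpan F := by
  obtain ⟨s, rfl⟩ := Module.Finite.iff_fg.1 ‹FiniteDimensional k V›
  choose t ht using B.proj_surjective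
  refine ⟨⋃ b ∈ s, ((wordBasis k θ).repr (t b)).support,
    s.finite_toSet.biUnion fun b _ => Finset.finite_toSet _, Submodule.span_le.2 fun b hb => ?_⟩
  have h1 := Submodule.mem_map_of_mem (f := B.proj.toLinearMap)
    ((wordBasis k θ).mem_span_repr_support (t b))
  rw [AlgHom.toLinearMap_apply, ht, Submodule.map_span, Set.image_image] at h1
  refine Submodule.span_mono (Set.image_mono ?_) h1
  exact Set.subset_biUnion_of_mem (u := fun b => (((wordBasis k θ).repr (t b)).support :
    Set (FreeMonoid (Fin θ)))) hb

instance (B : PreNichols q) (F : Set (FreeMonoid (Fin θ))) [Finite F] :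
    FiniteDimensional k (B.wordSpan F) :=
  FiniteDimensional.span_of_finite k (F.toFinite.image _)

/-- Twisting does not increase the Gelfand-Kirillov dimension. A finite-dimensional subspace lies
in the span of finitely many words, and all powers of such a span are spans of words, which the
twisting isomorphism respects. -/
theorem gkDim_twisted_le (h : TwistEquiv q p) (B : PreNichols q) :
    gkDim k (B.twisted h).Alg ≤ gkDim k B.Alg := by
  refine iSup_le fun ⟨V, hV⟩ => ?_
  obtain ⟨F, hF, hVF⟩ := (B.twisted h).exists_finite_le_wordSpan V
  have := hF.to_subtype
  refine le_iSup_of_le ⟨B.wordSpan F, inferInstance⟩ ?_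
  refine Filter.limsup_le_limsup (Filter.Eventually.of_forall fun n => ?_)
  have hle : (⨆ i : Fin (n + 1), V ^ (i : ℕ)).map (B.twistedEquiv h).toLinearMap ≤
      ⨆ i : Fin (n + 1), B.wordSpan F ^ (i : ℕ) := by
    rw [Submodule.map_iSup]
    refine iSup_mono fun i => ?_
    refine (Submodule.map_mono (pow_le_pow_left' hVF _)).trans ?_
    rw [wordSpan_pow, wordSpan_pow]
    exact map_twistedEquiv_wordSpan_le h B _
  have hfin : FiniteDimensional k
      (⨆ i : Fin (n + 1), B.wordSpan F ^ (i : ℕ) : Submodule k B.Alg) := by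
    have (i : Fin (n + 1)) : FiniteDimensional k (B.wordSpan F ^ (i : ℕ) : Submodule k B.Alg) :=
      Module.Finite.iff_fg.2 ((Module.Finite.iff_fg.1 inferInstance).pow _)
    infer_instance
  have hrank := Submodule.finrank_mono hle
  rw [LinearEquiv.finrank_map_eq] at hrank
  refine EReal.coe_le_coe_iff.2 (div_le_div_of_nonneg_right ?_ (Real.log_natCast_nonneg n))
  -- `Real.log 0 = 0`, so the logarithm is monotone on all natural numbers.
  rcases Nat.eq_zero_or_pos (Module.finrank k (⨆ i : Fin (n + 1), V ^ (i : ℕ) :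
    Submodule k (B.twisted h).Alg)) with h0 | h0
  · rw [h0, Nat.cast_zero, Real.log_zero]
    exact Real.log_natCast_nonneg _
  · exact Real.log_le_log (Nat.cast_pos.2 h0) (Nat.cast_le.2 hrank)

theorem gkDim_twisted (h : TwistEquiv q p) (B : PreNichols q) :
    gkDim k (B.twisted h).Alg = gkDim k B.Alg := by
  refine le_antisymm (gkDim_twisted_le h B) ?_
  conv_lhs => rw [← twisted_twisted h B]
  exact gkDim_twisted_le h.symm (B.twisted h)

end PreNichols

end DiagonalType

end

theorem mainTheorem7 {k : Type*} [Field k] {θ : ℕ} (q p : Matrix (Fin θ) (Fin θ) kˣ)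
    (hqp : DiagonalType.TwistEquiv q p) :
    DiagonalType.IsTwoCocycle (DiagonalType.twistCocycle q p) ∧
    ∃ Ψ : DiagonalType.PreNichols q ≃o DiagonalType.PreNichols p,
      (∀ B, DiagonalType.IsCocycleTwist (DiagonalType.twistCocycle q p) B (Ψ B)) ∧
      (∀ B, (Ψ B).hilbertSeries = B.hilbertSeries) ∧
      ∃ Φ : DiagonalType.FinPreNichols q ≃o DiagonalType.FinPreNichols p,
        ∀ B, (Φ B : DiagonalType.PreNichols p) = Ψ B := by
  let Ψ := DiagonalType.PreNichols.twistOrderIso hqp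
  refine ⟨DiagonalType.isTwoCocycle_twistCocycle q p, Ψ,
    DiagonalType.PreNichols.isCocycleTwist_twisted hqp,
    DiagonalType.PreNichols.hilbertSeries_twisted hqp, 
    { toEquiv := Ψ.toEquiv.subtypeEquiv fun B => ?_
      map_rel_iff' := Ψ.le_iff_le }, fun B => rfl⟩
  change _ ↔ DiagonalType.gkDim k (B.twisted hqp).Alg < ⊤
  rw [DiagonalType.PreNichols.gkDim_twisted]
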